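/- For an integer $n \ge 1$ let $X = (x_{ij})$ be the $n \times n$ symmetric matrix of indeterminates over $\mathbb{Z}$ (so $x_{ij} = x_{ji}$, and the $x_{ij}$ with $1 \le i \le j \le n$ are algebraically independent). Set $S = \mathbb{Z}[X] = \mathbb{Z}[x_{ij} : 1 \le i \le j \le n]$ and $R = S/(\det X)S$. For a prime integer $p$, the Frobenius endomorphism of $R/pR$ is the map $x \mapsto x^p$; it is said to lift to an endomorphism of $R/p^2R$ if there is a ring endomorphism $\Phi$ of $R/p^2R$ such that $\pi \circ \Phi = F \circ \pi$, where $\pi \colon R/p^2R \to R/pR$ is the canonical surjection and $F$ is the Frobenius endomorphism of $R/pR$. (a) If $n = 3$ and $p$ is an odd prime integer, then the Frobenius endomorphism of $R/pR$ lifts to an endomorphism of $R/p^2R$. (b) If $n \ge 3$, then the Frobenius endomorphism of $R/2R$ does not lift to an endomorphism of $R/4R$. (c) If $n \ge 4$ and $p$ is an odd prime integer, then the Frobenius endomorphism of $R/pR$ does not lift to an endomorphism of $R/p^2R$. -/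

import Mathlib

/-- The reduction map `R/p²R → R/pR`. -/
def reductionModP (p : ℕ) (R : Type*) [CommRing R] :
    R ⧸ Ideal.span {(p : R) ^ 2} →+* R ⧸ Ideal.span {(p : R)} :=
  Ideal.Quotient.factor
    ((Ideal.span_singleton_le_span_singleton).mpr (dvd_pow_self (p : R) two_ne_zero))

/-- In `R/pR` with `p` prime, taking `p`-th powers is additive. -/
theorem add_pow_prime_modP (p : ℕ) [hp : Fact p.Prime] (R : Type*) [CommRing R]
    (x y : R ⧸ Ideal.span {(p : R)}) : (x + y) ^ p = x ^ p + y ^ p := by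
  have h0 : (p : R ⧸ Ideal.span {(p : R)}) = 0 := by
    rw [← map_natCast (Ideal.Quotient.mk (Ideal.span {(p : R)}))]
    exact Ideal.Quotient.eq_zero_iff_mem.mpr (Ideal.mem_span_singleton_self _)
  obtain ⟨r, hr⟩ := exists_add_pow_prime_eq hp.out x y
  rw [hr, h0]
  ring

/-- The Frobenius endomorphism `x ↦ x ^ p` of the ring `R/pR`, for `p` prime. -/
def frobeniusModP (p : ℕ) [hp : Fact p.Prime] (R : Type*) [CommRing R] :
    R ⧸ Ideal.span {(p : R)} →+* R ⧸ Ideal.span {(p : R)} where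
  toFun x := x ^ p
  map_one' := one_pow p
  map_mul' x y := mul_pow x y p
  map_zero' := zero_pow hp.out.ne_zero
  map_add' := add_pow_prime_modP p R

/-- The Frobenius endomorphism of `R/pR` lifts to a ring endomorphism `Φ` of `R/p²R`: the square
formed by `Φ`, the Frobenius endomorphism and the reduction map `R/p²R → R/pR` commutes. -/
def FrobeniusLiftsModPSq (p : ℕ) [Fact p.Prime] (R : Type*) [CommRing R] : Prop :=
  ∃ Φ : R ⧸ Ideal.span {(p : R) ^ 2} →+* R ⧸ Ideal.span {(p : R) ^ 2},
    (reductionModP p R).comp Φ = (frobeniusModP p R).comp (reductionModP p R)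

/-- The generic symmetric `n × n` matrix over `ℤ`. The indeterminates are indexed by unordered
pairs `{i, j}` (with `i = j` allowed), and the entries `(i, j)` and `(j, i)` are both the
indeterminate `x_{ij}`. -/
noncomputable def genericSymmMatrix (n : ℕ) :
    Matrix (Fin n) (Fin n) (MvPolynomial (Sym2 (Fin n)) ℤ) :=
  Matrix.of fun i j => MvPolynomial.X s(i, j)

/-- The symmetric determinantal hypersurface `ℤ[X]/(det X)`, where `X` is an `n × n` symmetric
matrix of indeterminates. -/
abbrev SymmDetHypersurface (n : ℕ) : Type :=
  MvPolynomial (Sym2 (Fin n)) ℤ ⧸ Ideal.span {(genericSymmMatrix n).det}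

/-! Write `f` for the generic determinant. Frobenius lifts iff there are polynomials `g_ij = g_ji`
such that `det (x_ij ^ p + p g_ij)` lies in the ideal `(f, p²)`; this is `FrobeniusCongruence`.
Specialising to `diag(1, X)` passes the congruence to smaller sizes, so the negative claims need
only sizes 3 and 4.

Obstruction (`FrobeniusCongruence.sq_dvd_det`): substitute `x_ij ↦ m_ij l_i l_j` with `det m = 0`
and take the coefficient of `∏ l_i ^ (2p)`. If products of distinct diagonal entries of `m` vanish,
only the coefficient `c_ij` of `x_ij ^ p` in `g_ij` survives, so `p²` divides `det ((1 + p c_ij)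
m_ij ^ p)`. Explicit singular matrices over `ℤ` and `ℤ[X]` contradict this.

Existence: over an algebraically closed field of characteristic zero, a generic singular symmetric 3
× 3 matrix is `(y_i z_j + y_j z_i) / 2`. Raising `y` and `z` to `p`-th powers keeps this shape, and
the new entries are polynomials in the old ones, congruent to `x_ij ^ p` mod `p` when `p` is odd.
Gauss's lemma turns the vanishing on `f = 0` into divisibility by `f`. -/

section

open MvPolynomial

/-! ### Lifts of Frobenius as a determinant congruence -/

/-- The congruence satisfied by the images of the indeterminates under a lift of Frobenius. -/
def FrobeniusCongruence (p n : ℕ) : Prop :=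
  ∃ (g : Sym2 (Fin n) → MvPolynomial (Sym2 (Fin n)) ℤ) (A B : MvPolynomial (Sym2 (Fin n)) ℤ),
    (Matrix.of fun i j : Fin n => (X s(i, j) : MvPolynomial (Sym2 (Fin n)) ℤ) ^ p
      + (p : MvPolynomial (Sym2 (Fin n)) ℤ) * g s(i, j)).det =
      (genericSymmMatrix n).det * A + (p : MvPolynomial (Sym2 (Fin n)) ℤ) ^ 2 * B

theorem RingHom.map_genericSymmMatrix_det {n : ℕ} {U : Type*} [CommRing U]
    (φ : MvPolynomial (Sym2 (Fin n)) ℤ →+* U) :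
    φ (genericSymmMatrix n).det = (Matrix.of fun i j : Fin n => φ (X s(i, j))).det := by
  rw [RingHom.map_det]
  rfl

theorem frobeniusCongruence_of_lifts (p n : ℕ) [hp : Fact p.Prime]
    (h : FrobeniusLiftsModPSq p (SymmDetHypersurface n)) : FrobeniusCongruence p n := by
  obtain ⟨Φ, hΦ⟩ := h
  let q₁ : MvPolynomial (Sym2 (Fin n)) ℤ →+* SymmDetHypersurface n := Ideal.Quotient.mk _
  let q₂ : SymmDetHypersurface n →+*
    SymmDetHypersurface n ⧸ Ideal.span {(p : SymmDetHypersurface n) ^ 2} := Ideal.Quotient.mk _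
  have hq₁ : Function.Surjective q₁ := Ideal.Quotient.mk_surjective
  have hq₂ : Function.Surjective q₂ := Ideal.Quotient.mk_surjective
  have key : ∀ s : Sym2 (Fin n), ∃ g : MvPolynomial (Sym2 (Fin n)) ℤ,
      Φ (q₂ (q₁ (X s))) = q₂ (q₁ (X s ^ p + (p : MvPolynomial (Sym2 (Fin n)) ℤ) * g)) := by
    intro s
    obtain ⟨r, hr⟩ := hq₂ (Φ (q₂ (q₁ (X s))))
    have h1 := DFunLike.congr_fun hΦ (q₂ (q₁ (X s)))
    simp only [RingHom.comp_apply] at h1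
    rw [← hr] at h1
    have h2 : r - q₁ (X s) ^ p ∈ Ideal.span {(p : SymmDetHypersurface n)} := by
      rw [← Ideal.Quotient.eq, map_pow]
      exact h1
    obtain ⟨t, ht⟩ := Ideal.mem_span_singleton.mp h2
    obtain ⟨g, rfl⟩ := hq₁ t
    refine ⟨g, ?_⟩
    rw [← hr, map_add q₁, map_mul q₁, map_natCast q₁, map_pow q₁, ← ht, add_sub_cancel]
  choose g hg using key
  let θ : MvPolynomial (Sym2 (Fin n)) ℤ →+* MvPolynomial (Sym2 (Fin n)) ℤ :=
    (aeval fun s => X s ^ p + (p : MvPolynomial (Sym2 (Fin n)) ℤ) * g s).toRingHom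
  have hθX : ∀ s, θ (X s) = X s ^ p + (p : MvPolynomial (Sym2 (Fin n)) ℤ) * g s :=
    fun s => aeval_X _ s
  have hθ : (Φ.comp q₂).comp q₁ = (q₂.comp q₁).comp θ := by
    refine MvPolynomial.ringHom_ext (fun a => by simp) fun s => ?_
    simp only [RingHom.comp_apply, hθX]
    exact hg s
  have h0 := DFunLike.congr_fun hθ (genericSymmMatrix n).det
  have hdet : q₁ (genericSymmMatrix n).det = 0 :=
    Ideal.Quotient.eq_zero_iff_mem.mpr (Ideal.mem_span_singleton_self _)
  simp only [RingHom.comp_apply, hdet, map_zero] at h0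
  obtain ⟨t, ht⟩ := Ideal.mem_span_singleton.mp (Ideal.Quotient.eq_zero_iff_mem.mp h0.symm)
  obtain ⟨B, rfl⟩ := hq₁ t
  have h3 : q₁ (θ (genericSymmMatrix n).det - (p : MvPolynomial (Sym2 (Fin n)) ℤ) ^ 2 * B) = 0 := by
    rw [map_sub, ht, map_mul, map_pow, map_natCast, sub_self]
  obtain ⟨A, hA⟩ := Ideal.mem_span_singleton.mp (Ideal.Quotient.eq_zero_iff_mem.mp h3)
  refine ⟨g, A, B, ?_⟩
  rw [← hA, sub_add_cancel, RingHom.map_genericSymmMatrix_det]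
  simp only [hθX]

theorem FrobeniusCongruence.lifts_of_surjective {p n : ℕ} [hp : Fact p.Prime]
    (h : FrobeniusCongruence p n) {R : Type*} [CommRing R]
    (q : MvPolynomial (Sym2 (Fin n)) ℤ →+* R) (hq : Function.Surjective q)
    (hdet : q (genericSymmMatrix n).det = 0) (hker : ∀ a, q a = 0 → (genericSymmMatrix n).det ∣ a) :
    FrobeniusLiftsModPSq p R := by
  obtain ⟨g, A, B, hg⟩ := h
  let q₂ : R →+* R ⧸ Ideal.span {(p : R) ^ 2} := Ideal.Quotient.mk _
  have hp2 : (p : R ⧸ Ideal.span {(p : R) ^ 2}) ^ 2 = 0 := by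
    have : q₂ ((p : R) ^ 2) = 0 :=
      Ideal.Quotient.eq_zero_iff_mem.mpr (Ideal.mem_span_singleton_self _)
    simpa using this
  let θ : MvPolynomial (Sym2 (Fin n)) ℤ →+* MvPolynomial (Sym2 (Fin n)) ℤ :=
    (aeval fun s => X s ^ p + (p : MvPolynomial (Sym2 (Fin n)) ℤ) * g s).toRingHom
  have hθX : ∀ s, θ (X s) = X s ^ p + (p : MvPolynomial (Sym2 (Fin n)) ℤ) * g s :=
    fun s => aeval_X _ s
  have hθ : (q₂.comp (q.comp θ)) (genericSymmMatrix n).det = 0 := by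
    simp only [RingHom.comp_apply]
    rw [RingHom.map_genericSymmMatrix_det]
    simp only [hθX]
    rw [hg]
    simp only [map_add, map_mul, hdet, map_pow, map_natCast, hp2, map_zero, zero_mul, add_zero]
  let Φ₁ : R →+* R ⧸ Ideal.span {(p : R) ^ 2} :=
    q.liftOfSurjective hq ⟨q₂.comp (q.comp θ), by
      intro a ha
      obtain ⟨b, rfl⟩ := hker a ha
      rw [RingHom.mem_ker, map_mul, hθ, zero_mul]⟩
  have hΦ₁ : ∀ x, Φ₁ (q x) = q₂ (q (θ x)) := fun x =>
    RingHom.liftOfRightInverse_comp_apply q _ _ _ x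
  let Φ := Ideal.Quotient.lift (Ideal.span {(p : R) ^ 2}) Φ₁ (by
      intro a ha
      obtain ⟨b, rfl⟩ := Ideal.mem_span_singleton.mp ha
      rw [map_mul, map_pow, map_natCast, hp2, zero_mul])
  refine ⟨Φ, ?_⟩
  have hΦ : ∀ x, Φ (q₂ (q x)) = q₂ (q (θ x)) := hΦ₁
  have h0 : (p : R ⧸ Ideal.span {(p : R)}) = 0 := by
    rw [← map_natCast (Ideal.Quotient.mk (Ideal.span {(p : R)}))]
    exact Ideal.Quotient.eq_zero_iff_mem.mpr (Ideal.mem_span_singleton_self _)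
  refine Ideal.Quotient.ringHom_ext (RingHom.cancel_right hq |>.mp
    (MvPolynomial.ringHom_ext (fun a => by simp) fun s => ?_))
  change (reductionModP p _) (Φ (q₂ (q (X s)))) = (reductionModP p _ (q₂ (q (X s)))) ^ p
  rw [hΦ, hθX]
  simp only [map_add, map_mul, map_pow, map_natCast, h0, zero_mul, add_zero]

theorem FrobeniusCongruence.lifts {p n : ℕ} [hp : Fact p.Prime] (h : FrobeniusCongruence p n) :
    FrobeniusLiftsModPSq p (SymmDetHypersurface n) :=
  h.lifts_of_surjective (Ideal.Quotient.mk _) Ideal.Quotient.mk_surjective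
    (Ideal.Quotient.eq_zero_iff_mem.mpr (Ideal.mem_span_singleton_self _))
    fun _ ha => Ideal.mem_span_singleton.mp (Ideal.Quotient.eq_zero_iff_mem.mp ha)

/-! ### Descent to smaller matrices -/

theorem Matrix.dvd_det_of_dvd_column {n : ℕ} {U : Type*} [CommRing U]
    (N : Matrix (Fin n) (Fin n) U) (a : U) (j : Fin n) (h : ∀ i, a ∣ N i j) : a ∣ N.det := by
  rw [Matrix.det_apply]
  refine Finset.dvd_sum fun σ _ => ?_
  rw [Units.smul_def, zsmul_eq_mul]
  refine Dvd.dvd.mul_left ?_ _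
  exact (h (σ j)).trans (Finset.dvd_prod_of_mem (fun i => N (σ i) i) (Finset.mem_univ j))

/-- Modulo the square of `a`, a matrix with first row and column congruent to those of the identity
modulo `a` has the determinant of a block diagonal matrix. -/
theorem Matrix.sq_dvd_det_sub_of_dvd {n : ℕ} {U : Type*} [CommRing U]
    (N : Matrix (Fin (n + 1)) (Fin (n + 1)) U) (a : U)
    (hr : ∀ j : Fin n, a ∣ N 0 j.succ) (hc : ∀ i : Fin n, a ∣ N i.succ 0) :
    a ^ 2 ∣ N.det - N 0 0 * (N.submatrix Fin.succ Fin.succ).det := by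
  rw [Matrix.det_succ_row_zero, Fin.sum_univ_succ]
  simp only [Fin.val_zero, pow_zero, one_mul]
  rw [show (0 : Fin (n + 1)).succAbove = Fin.succ from funext fun i => Fin.zero_succAbove i,
    add_sub_cancel_left]
  refine Finset.dvd_sum fun j _ => ?_
  obtain _ | n := n
  · exact j.elim0
  rw [mul_assoc, sq]
  refine Dvd.dvd.mul_left (mul_dvd_mul (hr j) ?_) _
  refine Matrix.dvd_det_of_dvd_column _ a 0 fun i => ?_
  simpa using hc i

/-- Specialise the generic matrix to `diag(1, X)`. Off-diagonal entries of the first row and column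
become multiples of `p`, so mod `p²` they do not affect the determinant. -/
theorem FrobeniusCongruence.of_succ {p n : ℕ} (hp : p ≠ 0) (h : FrobeniusCongruence p (n + 1)) :
    FrobeniusCongruence p n := by
  obtain ⟨g, A, B, hg⟩ := h
  let M : Matrix (Fin (n + 1)) (Fin (n + 1)) (MvPolynomial (Sym2 (Fin n)) ℤ) := fun i j =>
    Fin.cases (Fin.cases 1 (fun _ => 0) j) (fun i' => Fin.cases 0 (fun j' => X s(i', j')) j) i
  have hM : ∀ i j, M i j = M j i := by
    intro i j
    refine Fin.cases ?_ (fun i => ?_) i <;> refine Fin.cases ?_ (fun j => ?_) j <;>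
      simp [M, Sym2.eq_swap]
  let θ : MvPolynomial (Sym2 (Fin (n + 1))) ℤ →+* MvPolynomial (Sym2 (Fin n)) ℤ :=
    (aeval (Sym2.lift ⟨M, hM⟩)).toRingHom
  have hθ : ∀ i j, θ (X s(i, j)) = M i j := fun i j => aeval_X _ s(i, j)
  have hf : θ (genericSymmMatrix (n + 1)).det = (genericSymmMatrix n).det := by
    rw [RingHom.map_genericSymmMatrix_det]
    simp only [hθ]
    rw [Matrix.det_succ_row_zero, Fin.sum_univ_succ, Finset.sum_eq_zero]
    · simp only [M, Fin.val_zero, pow_zero, one_mul, Matrix.of_apply, Fin.cases_zero, add_zero]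
      congr 1
    · intro j _
      simp [M]
  have h1 := congrArg θ hg
  rw [RingHom.map_det] at h1
  simp only [map_add, map_mul, map_pow, map_natCast, hf] at h1
  obtain ⟨C, hC⟩ := Matrix.sq_dvd_det_sub_of_dvd
    (θ.mapMatrix (Matrix.of fun i j : Fin (n + 1) =>
      (X s(i, j) : MvPolynomial (Sym2 (Fin (n + 1))) ℤ) ^ p + (p : MvPolynomial _ ℤ) * g s(i, j)))
    (p : MvPolynomial (Sym2 (Fin n)) ℤ)
    (fun j => by simp [hθ, M, hp]) (fun i => by simp [hθ, M, hp])
  rw [h1] at hC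
  have h2 : (θ.mapMatrix (Matrix.of fun i j : Fin (n + 1) =>
      (X s(i, j) : MvPolynomial (Sym2 (Fin (n + 1))) ℤ) ^ p +
        (p : MvPolynomial _ ℤ) * g s(i, j))).submatrix Fin.succ Fin.succ =
      Matrix.of fun i j : Fin n => (X s(i, j) : MvPolynomial (Sym2 (Fin n)) ℤ) ^ p +
        (p : MvPolynomial _ ℤ) * (fun s : Sym2 (Fin n) => θ (g (s.map Fin.succ))) s(i, j) := by
    ext1 i j
    simp [hθ, M]
  rw [h2] at hC
  have h3 : θ.mapMatrix (Matrix.of fun i j : Fin (n + 1) =>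
      (X s(i, j) : MvPolynomial (Sym2 (Fin (n + 1))) ℤ) ^ p +
        (p : MvPolynomial _ ℤ) * g s(i, j)) 0 0 = 1 + p * θ (g s(0, 0)) := by
    simp [hθ, M]
  rw [h3] at hC
  set D := (Matrix.of fun i j : Fin n => (X s(i, j) : MvPolynomial (Sym2 (Fin n)) ℤ) ^ p +
        (p : MvPolynomial _ ℤ) * (fun s : Sym2 (Fin n) => θ (g (s.map Fin.succ))) s(i, j)).det
    with hD
  set e := θ (g s(0, 0))
  -- The corner entry `1 + p e` is inverted mod `p²` by `1 - p e`; the error `p² e² D` goes into the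
  -- last witness.
  refine ⟨fun s => θ (g (s.map Fin.succ)), θ A * (1 - p * e),
    (θ B - C) * (1 - p * e) + e ^ 2 * D, ?_⟩
  rw [← hD]
  linear_combination (-(1 - p * e)) * hC

theorem FrobeniusCongruence.of_le {p m n : ℕ} (hp : p ≠ 0) (hmn : m ≤ n)
    (h : FrobeniusCongruence p n) : FrobeniusCongruence p m := by
  induction n, hmn using Nat.le_induction with
  | base => exact h
  | succ n _ ih => exact ih (h.of_succ hp)

/-! ### Extracting a multigraded coefficient -/

/-- Mod `p²` at most one factor contributes its `G i`. The others contribute monomials, so only the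
coefficient of `G i` at its own exponent `e i` reaches the total exponent. -/
theorem MvPolynomial.exists_prod_monomial_add {σ ι T : Type*} [CommRing T] [DecidableEq ι]
    (p : ℕ) (s : Finset ι) (e : ι → σ →₀ ℕ) (a : ι → T) (G : ι → MvPolynomial σ T) :
    ∃ Q : MvPolynomial σ T,
      ∏ i ∈ s, (monomial (e i) (a i) + (p : MvPolynomial σ T) * G i) =
        monomial (∑ i ∈ s, e i) (∏ i ∈ s, a i) + (p : MvPolynomial σ T) * Q ∧
      (p : T) ^ 2 ∣ (∏ i ∈ s, a i + p * coeff (∑ i ∈ s, e i) Q) -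
        ∏ i ∈ s, (a i + p * coeff (e i) (G i)) := by
  induction s using Finset.induction_on with
  | empty => exact ⟨0, by simp⟩
  | insert j s hj ih =>
    obtain ⟨Q, hQ, B, hB⟩ := ih
    refine ⟨monomial (e j) (a j) * Q + G j * monomial (∑ i ∈ s, e i) (∏ i ∈ s, a i) +
      C (p : T) * (G j * Q), ?_, ?_⟩
    · rw [Finset.prod_insert hj, Finset.prod_insert hj, Finset.sum_insert hj, hQ,
        ← one_mul (monomial (e j + _) _), one_mul, ← monomial_mul, map_natCast]
      ring
    · rw [Finset.prod_insert hj, Finset.prod_insert hj, Finset.sum_insert hj, coeff_add, coeff_add,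
        coeff_monomial_mul, coeff_mul_monomial, coeff_C_mul]
      refine ⟨(a j + p * coeff (e j) (G j)) * B - coeff (e j) (G j) * coeff (∑ i ∈ s, e i) Q +
        coeff (e j + ∑ i ∈ s, e i) (G j * Q), ?_⟩
      linear_combination (a j + p * coeff (e j) (G j)) * hB

theorem MvPolynomial.sq_dvd_coeff_prod_monomial_add {σ ι T : Type*} [CommRing T] [DecidableEq ι]
    (p : ℕ) (s : Finset ι) (e : ι → σ →₀ ℕ) (a : ι → T) (G : ι → MvPolynomial σ T) :
    (p : T) ^ 2 ∣ coeff (∑ i ∈ s, e i)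
        (∏ i ∈ s, (monomial (e i) (a i) + (p : MvPolynomial σ T) * G i)) -
      ∏ i ∈ s, (a i + p * coeff (e i) (G i)) := by
  classical
  obtain ⟨Q, hQ, h⟩ := exists_prod_monomial_add p s e a G
  rw [hQ, coeff_add, ← map_natCast (C (σ := σ) (R := T)), coeff_C_mul, coeff_monomial, if_pos rfl]
  exact h

/-- The degree of an unordered pair in the grading by the free abelian monoid on the vertices. -/
noncomputable def Sym2.vertexDegree {V : Type*} (s : Sym2 V) : V →₀ ℕ :=
  Sym2.lift ⟨fun i j => Finsupp.single i 1 + Finsupp.single j 1, fun _ _ => add_comm _ _⟩ s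

@[simp] theorem Sym2.vertexDegree_mk {V : Type*} (i j : V) :
    Sym2.vertexDegree s(i, j) = Finsupp.single i 1 + Finsupp.single j 1 := rfl

section

variable {V T : Type*} [CommRing T]

/-- The substitution `x_{ij} ↦ m_{ij} l_i l_j`. -/
noncomputable def scaledSubst (m : Sym2 V → T) : MvPolynomial (Sym2 V) ℤ →+* MvPolynomial V T :=
  (aeval fun s => monomial s.vertexDegree (m s)).toRingHom

theorem scaledSubst_X (m : Sym2 V → T) (s : Sym2 V) :
    scaledSubst m (X s) = monomial s.vertexDegree (m s) := aeval_X _ s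

theorem scaledSubst_monomial (m : Sym2 V → T) (d : Sym2 V →₀ ℕ) (a : ℤ) :
    scaledSubst m (monomial d a) =
      monomial (d.sum fun s k => k • s.vertexDegree) (a * d.prod fun s k => m s ^ k) := by
  change aeval _ _ = _
  rw [aeval_monomial]
  simp only [monomial_pow]
  rw [Finsupp.prod, Finsupp.prod, Finsupp.sum, ← monomial_sum_prod]
  simp [← C_mul_monomial]

theorem Finsupp.eq_single_vertexDegree {d : Sym2 V →₀ ℕ} {p : ℕ} {s : Sym2 V}
    (h : (d.sum fun t k => k • t.vertexDegree) = p • s.vertexDegree)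
    (hd : ∀ t ∈ d.support, t = s) : d = Finsupp.single s p := by
  classical
  have h1 : d = Finsupp.single s (d s) := by
    refine Finsupp.ext fun t => ?_
    rw [Finsupp.single_apply]
    split_ifs with hts
    · rw [hts]
    · by_contra hne
      exact hts (hd t (Finsupp.mem_support_iff.mpr hne)).symm
  rw [h1]
  congr 1
  rw [h1, Finsupp.sum_single_index (h := fun t k => k • Sym2.vertexDegree t) (zero_nsmul _)] at h
  induction s using Sym2.ind with | _ i j
  have h2 := DFunLike.congr_fun h i
  simp only [Finsupp.smul_apply, smul_eq_mul] at h2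
  refine Nat.eq_of_mul_eq_mul_right ?_ h2
  simp

/-- The exponents of this degree are those of `x_ij ^ (p - 2k) * (x_ii x_jj) ^ k`. If `i ≠ j`, any
one with `k > 0` contains both loops and is killed by `hm`. -/
theorem Finsupp.prod_eq_zero_of_vertexDegree {m : Sym2 V → T}
    (hm : ∀ i j, i ≠ j → m s(i, i) * m s(j, j) = 0) {d : Sym2 V →₀ ℕ} {p : ℕ} {s : Sym2 V}
    (h : (d.sum fun t k => k • t.vertexDegree) = p • s.vertexDegree)
    (hd : d ≠ Finsupp.single s p) : (d.prod fun t k => m t ^ k) = 0 := by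
  classical
  induction s using Sym2.ind with | _ i j
  have hk : ∀ k, ∑ t ∈ d.support, d t * t.vertexDegree k =
      p * (Sym2.vertexDegree s(i, j)) k := by
    intro k
    have := DFunLike.congr_fun h k
    rwa [Finsupp.sum, Finsupp.finsetSum_apply] at this
  have hmem : ∀ a b, s(a, b) ∈ d.support → a = i ∨ a = j := by
    intro a b hab
    by_contra! hne
    have := hk a
    rw [show (Sym2.vertexDegree s(i, j)) a = 0 by
      simp [hne.1.symm, hne.2.symm], mul_zero,
      Finset.sum_eq_zero_iff] at this
    have h2 := this _ hab
    rw [Finsupp.mem_support_iff] at hab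
    simp [hab] at h2
  have hmem' : ∀ a b, s(a, b) ∈ d.support → (a = i ∨ a = j) ∧ (b = i ∨ b = j) :=
    fun a b hab => ⟨hmem a b hab, hmem b a (Sym2.eq_swap ▸ hab)⟩
  by_cases hij : i = j
  · subst hij
    refine (hd (Finsupp.eq_single_vertexDegree h fun t => ?_)).elim
    induction t using Sym2.ind with | _ a b
    intro hab
    obtain ⟨h1, h2⟩ := hmem' a b hab
    simp only [or_self] at h1 h2
    rw [h1, h2]
  -- Without a loop at `i`, each edge meets `j` at least as often as `i`. Equal total degrees force
  -- equality edge by edge, which excludes loops at `j`.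
  have half : ∀ i j : V, i ≠ j → (∀ a b, s(a, b) ∈ d.support → (a = i ∨ a = j) ∧ (b = i ∨ b = j)) →
      ∑ t ∈ d.support, d t * t.vertexDegree i = ∑ t ∈ d.support, d t * t.vertexDegree j →
      s(i, i) ∉ d.support → ∀ t ∈ d.support, t = s(i, j) := by
    intro i j hij hmem' he hi
    have hle : ∀ t ∈ d.support, d t * t.vertexDegree i ≤ d t * t.vertexDegree j := by
      intro t
      induction t using Sym2.ind with | _ a b
      intro hab
      refine Nat.mul_le_mul_left _ ?_
      obtain ⟨rfl | rfl, rfl | rfl⟩ := hmem' a b hab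
      · exact (hi hab).elim
      all_goals simp [hij, hij.symm]
    have heq := (Finset.sum_eq_sum_iff_of_le hle).mp he
    intro t ht
    have h1 := heq t ht
    revert ht
    induction t using Sym2.ind with | _ a b
    intro hab
    have h2 := Nat.eq_of_mul_eq_mul_left (Nat.pos_of_ne_zero (Finsupp.mem_support_iff.mp hab)) h1
    obtain ⟨rfl | rfl, rfl | rfl⟩ := hmem' a b hab
    · exact (hi hab).elim
    · rfl
    · exact Sym2.eq_swap
    · simp [hij] at h2
  have he : ∑ t ∈ d.support, d t * t.vertexDegree i = ∑ t ∈ d.support, d t * t.vertexDegree j := by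
    rw [hk, hk]
    simp [hij, Ne.symm hij]
  by_cases hi : s(i, i) ∈ d.support
  · by_cases hj : s(j, j) ∈ d.support
    · have hsub : ({s(i, i), s(j, j)} : Finset (Sym2 V)) ⊆ d.support := by
        intro t ht
        simp only [Finset.mem_insert, Finset.mem_singleton] at ht
        rcases ht with rfl | rfl <;> assumption
      have hdvd := Finset.prod_dvd_prod_of_subset _ _ (fun t => m t ^ d t) hsub
      rw [Finset.prod_pair (by simpa [Sym2.eq_iff] using hij)] at hdvd
      rw [← zero_dvd_iff, ← hm i j hij]
      exact (mul_dvd_mul (dvd_pow_self _ (Finsupp.mem_support_iff.mp hi))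
        (dvd_pow_self _ (Finsupp.mem_support_iff.mp hj))).trans hdvd
    · refine (hd (Finsupp.eq_single_vertexDegree h fun t ht => ?_)).elim
      rw [Sym2.eq_swap]
      exact half j i (Ne.symm hij) (fun a b hab => ⟨(hmem' a b hab).1.symm, (hmem' a b hab).2.symm⟩)
        he.symm hj t ht
  · exact (hd (Finsupp.eq_single_vertexDegree h (half i j hij hmem' he hi))).elim

theorem coeff_scaledSubst {m : Sym2 V → T} (hm : ∀ i j, i ≠ j → m s(i, i) * m s(j, j) = 0)
    (p : ℕ) (s : Sym2 V) (g : MvPolynomial (Sym2 V) ℤ) :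
    coeff (p • s.vertexDegree) (scaledSubst m g) = coeff (Finsupp.single s p) g * m s ^ p := by
  classical
  induction g using MvPolynomial.induction_on' with
  | monomial d a =>
    rw [scaledSubst_monomial, coeff_monomial, coeff_monomial]
    by_cases hd : d = Finsupp.single s p
    · subst hd
      simp [Finsupp.sum_single_index, Finsupp.prod_single_index]
    · rw [if_neg hd, Int.cast_zero, zero_mul]
      split_ifs with h
      · rw [Finsupp.prod_eq_zero_of_vertexDegree hm h hd, mul_zero]
      · rfl
  | add f g hf hg => rw [map_add, coeff_add, coeff_add, hf, hg, Int.cast_add, add_mul]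

end

theorem FrobeniusCongruence.sq_dvd_det {p n : ℕ} (h : FrobeniusCongruence p n) :
    ∃ c : Sym2 (Fin n) → ℤ, ∀ (T : Type) [CommRing T] (M : Matrix (Fin n) (Fin n) T),
      M.IsSymm → M.det = 0 → (∀ i j, i ≠ j → M i i * M j j = 0) →
      (p : T) ^ 2 ∣ (Matrix.of fun i j => (1 + p * (c s(i, j) : T)) * M i j ^ p).det := by
  obtain ⟨g, A, B, hg⟩ := h
  refine ⟨fun s => coeff (Finsupp.single s p) (g s), fun T _ M hM hdet hdiag => ?_⟩
  let m : Sym2 (Fin n) → T := Sym2.lift ⟨fun i j => M i j, fun i j => hM.apply j i⟩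
  have hm : ∀ i j, m s(i, j) = M i j := fun i j => rfl
  -- The substituted matrix is `L M L` with `L = diag(l_i)`, and `det M = 0`.
  have hf : scaledSubst m (genericSymmMatrix n).det = 0 := by
    rw [RingHom.map_genericSymmMatrix_det]
    simp only [scaledSubst_X, Sym2.vertexDegree_mk, hm]
    have : (Matrix.of fun i j : Fin n => monomial (Finsupp.single i 1 + Finsupp.single j 1) (M i j))
        = Matrix.diagonal (fun i => (X i : MvPolynomial (Fin n) T)) * M.map C *
          Matrix.diagonal (fun i => (X i : MvPolynomial (Fin n) T)) := by
      ext1 i j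
      rw [Matrix.mul_diagonal, Matrix.diagonal_mul, Matrix.map_apply, Matrix.of_apply, X, X,
        mul_assoc, C_mul_monomial, monomial_mul]
      simp
    rw [this, Matrix.det_mul, Matrix.det_mul, ← RingHom.mapMatrix_apply, ← RingHom.map_det, hdet]
    simp
  have h1 := congrArg (scaledSubst m) hg
  simp only [map_add, map_mul, hf, zero_mul, zero_add, map_pow, map_natCast] at h1
  rw [RingHom.map_det] at h1
  set E : Fin n →₀ ℕ := ∑ i, 2 • p • Finsupp.single i 1 with hE
  have hEσ : ∀ σ : Equiv.Perm (Fin n), ∑ i, p • Sym2.vertexDegree s(σ i, i) = E := by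
    intro σ
    simp only [Sym2.vertexDegree_mk, smul_add, Finset.sum_add_distrib, hE, two_smul]
    rw [Equiv.sum_comp σ (fun i => p • Finsupp.single i 1)]
  have h2 : (p : T) ^ 2 ∣ coeff E ((scaledSubst m).mapMatrix (Matrix.of fun i j : Fin n =>
      (X s(i, j) : MvPolynomial (Sym2 (Fin n)) ℤ) ^ p + (p : MvPolynomial _ ℤ) * g s(i, j))).det := by
    rw [h1, ← map_natCast (C (σ := Fin n) (R := T)), ← C_pow, coeff_C_mul]
    exact dvd_mul_right _ _
  rw [← dvd_sub_right h2, Matrix.det_apply, Matrix.det_apply, coeff_sum, ← Finset.sum_sub_distrib]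
  refine Finset.dvd_sum fun σ _ => ?_
  rw [Units.smul_def, Units.smul_def, coeff_smul, ← smul_sub, zsmul_eq_mul]
  refine Dvd.dvd.mul_left ?_ _
  have h3 := sq_dvd_coeff_prod_monomial_add p Finset.univ
    (fun i => p • Sym2.vertexDegree s(σ i, i)) (fun i => M (σ i) i ^ p)
    (fun i => scaledSubst m (g s(σ i, i)))
  rw [hEσ] at h3
  convert h3 using 4 with i _ i _
  · simp [scaledSubst_X, monomial_pow, hm]
  · rw [coeff_scaledSubst hdiag, hm, Matrix.of_apply]
    ring

end

/-! ### The two obstructions: `p = 2` in size 3, odd `p` in size 4 -/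

theorem not_frobeniusCongruence_two_three : ¬ FrobeniusCongruence 2 3 := by
  intro h
  obtain ⟨c, hc⟩ := h.sq_dvd_det
  -- This matrix is singular because its two 3-cycle terms cancel against `2 * x_01 ^ 2`. After
  -- squaring, the diagonal entry 2 becomes 4, so the determinant is 2 mod 4.
  have h1 := hc ℤ !![0, 1, 1; 1, 0, 1; 1, 1, 2] (by decide) (by simp [Matrix.det_fin_three])
    (by decide)
  rw [Matrix.det_fin_three] at h1
  simp only [Matrix.of_apply, Sym2.eq_swap (a := (1 : Fin 3)) (b := 0),
    Sym2.eq_swap (a := (2 : Fin 3)) (b := 0), Sym2.eq_swap (a := (2 : Fin 3)) (b := 1)] at h1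
  simp at h1
  obtain ⟨k, hk⟩ := h1
  generalize c s(0, 1) = a at hk
  generalize c s(0, 2) = b at hk
  generalize c s(1, 2) = d at hk
  generalize c s(2, 2) = e at hk
  have h2 : (4 : ℤ) ∣ 2 := ⟨k - (a + b + d) - 2 * (a * b + b * d + d * a) - 4 * a * b * d +
    (1 + 2 * a) ^ 2 * (1 + 2 * e), by linear_combination hk⟩
  norm_num at h2

/-- With `P`, `Q`, `R` the products over the three perfect matchings, this is `P² + Q² + R² - 2PQ -
2PR - 2QR`, which vanishes when `√P + √Q = √R`. -/
theorem Matrix.det_fin_four_of_isSymm_of_diag_eq_zero {U : Type*} [CommRing U]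
    (N : Matrix (Fin 4) (Fin 4) U) (hN : N.IsSymm) (hd : ∀ i, N i i = 0) :
    N.det = (N 0 1 * N 2 3 + N 0 2 * N 1 3 - N 0 3 * N 1 2) ^ 2 -
      4 * (N 0 1 * N 2 3) * (N 0 2 * N 1 3) := by
  rw [Matrix.det_succ_row_zero]
  simp [Fin.sum_univ_succ, Matrix.det_fin_three, Fin.succAbove, hd]
  rw [hN.apply 0 1, hN.apply 0 2, hN.apply 0 3, hN.apply 1 2, hN.apply 1 3, hN.apply 2 3]
  ring

open Polynomial in
theorem not_frobeniusCongruence_four (p : ℕ) [hp : Fact p.Prime] (hodd : Odd p) :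
    ¬ FrobeniusCongruence p 4 := by
  intro h
  obtain ⟨c, hc⟩ := h.sq_dvd_det
  -- The matching products are `X²`, `1` and `(X + 1)²`, so the determinant vanishes. The failure of
  -- `(X + 1) ^ p = X ^ p + 1` mod `p²` gives the contradiction.
  let M : Matrix (Fin 4) (Fin 4) ℤ[X] :=
    !![0, X, 1, X + 1; X, 0, X + 1, 1; 1, X + 1, 0, X; X + 1, 1, X, 0]
  have hM : M.IsSymm := by
    ext1 i j
    fin_cases i <;> fin_cases j <;> rfl
  have hd : ∀ i, M i i = 0 := by
    intro i
    fin_cases i <;> rfl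
  have h1 := hc ℤ[X] M hM (by
    rw [Matrix.det_fin_four_of_isSymm_of_diag_eq_zero M hM hd]
    simp [M]
    ring) (fun i j _ => by rw [hd i, zero_mul])
  have hp0 : (p : ℤ[X]) ≠ 0 := Nat.cast_ne_zero.mpr hp.out.ne_zero
  have hp3 : 3 ≤ p := by
    have := hp.out.two_le
    obtain ⟨k, rfl⟩ := hodd
    omega
  rw [Matrix.det_fin_four_of_isSymm_of_diag_eq_zero _
    (by
      ext1 i j
      rw [Matrix.transpose_apply, Matrix.of_apply, Matrix.of_apply, Sym2.eq_swap, hM.apply])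
    (fun i => by rw [Matrix.of_apply, hd, zero_pow hp.out.ne_zero, mul_zero])] at h1
  simp [M] at h1
  obtain ⟨B, hB⟩ := h1
  obtain ⟨r, hr⟩ := exists_add_pow_prime_eq hp.out (X : ℤ[X]) 1
  have hr0 : (X * r).coeff 1 = 1 := by
    have h2 := congrArg (fun f => Polynomial.coeff f 1) hr
    simp only [mul_assoc, coeff_X_add_one_pow, coeff_add, coeff_X_pow, one_pow, one_mul,
      Polynomial.coeff_one, Polynomial.coeff_natCast_mul, Nat.choose_one_right] at h2
    rw [if_neg (by omega), if_neg (by omega), zero_add, zero_add] at h2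
    exact (mul_left_cancel₀ (Nat.cast_ne_zero.mpr hp.out.ne_zero) ((mul_one _).trans h2)).symm
  have hC : ((X : ℤ[X]) + 1) ^ p = X ^ p + 1 + (p : ℤ[X]) * (X * r) := by
    rw [hr]
    ring
  rw [hC] at hB
  generalize X * r = C at hr0 hB
  set a : ℤ[X] := X ^ p with ha
  obtain ⟨α, hα⟩ : ∃ α : ℤ, α = c s(0, 1) + c s(2, 3) + p * c s(0, 1) * c s(2, 3) := ⟨_, rfl⟩
  obtain ⟨β, hβ⟩ : ∃ β : ℤ, β = c s(0, 2) + c s(1, 3) + p * c s(0, 2) * c s(1, 3) := ⟨_, rfl⟩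
  obtain ⟨γ, hγ⟩ : ∃ γ : ℤ, γ = c s(0, 3) + c s(1, 2) + p * c s(0, 3) * c s(1, 2) := ⟨_, rfl⟩
  have hα' := congrArg (Int.cast (R := ℤ[X])) hα
  have hβ' := congrArg (Int.cast (R := ℤ[X])) hβ
  have hγ' := congrArg (Int.cast (R := ℤ[X])) hγ
  push_cast at hα' hβ' hγ'
  have hB' : (a ^ 2 * (1 + (p : ℤ[X]) * α) + (1 + (p : ℤ[X]) * β) -
      (a + 1 + (p : ℤ[X]) * C) ^ 2 * (1 + (p : ℤ[X]) * γ)) ^ 2 -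
      4 * (a ^ 2 * (1 + (p : ℤ[X]) * α)) * (1 + (p : ℤ[X]) * β) = (p : ℤ[X]) ^ 2 * B := by
    rw [← hB, hα', hβ', hγ']
    ring
  clear hB hα hβ hγ hα' hβ' hγ' hr hC hc h
  -- The left side is the first-order term in `p` at the point `(a², 1, (a + 1)²)`, where the
  -- zeroth-order term vanishes.
  obtain ⟨Z, hZ⟩ : ∃ Z, (p : ℤ[X]) * (4 * a * (a + 1) * (2 * C - α * a - β + γ * (a + 1))) =
      (p : ℤ[X]) * (p * Z) := by
    refine ⟨B - ((a ^ 2 * α + β - (2 * (a + 1) * C + p * C ^ 2 + γ * (a + 1 + p * C) ^ 2)) ^ 2 -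
      4 * a ^ 2 * α * β) - 4 * a * (C ^ 2 + 2 * γ * (a + 1) * C + p * γ * C ^ 2), ?_⟩
    linear_combination hB'
  have hZ' := congrArg (Polynomial.mapRingHom (Int.castRingHom (ZMod p))) (mul_left_cancel₀ hp0 hZ)
  rw [map_mul, map_mul _ (p : ℤ[X]), map_natCast, ← Polynomial.C_eq_natCast (R := ZMod p),
    CharP.cast_eq_zero, map_zero, zero_mul, mul_eq_zero] at hZ'
  have h2 : (2 : ZMod p) ≠ 0 := by
    intro h2
    have := (CharP.cast_eq_zero_iff (ZMod p) p 2).mp (by exact_mod_cast h2)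
    have := Nat.le_of_dvd two_pos this
    omega
  rcases hZ' with h0 | h0
  · have h4 : (4 : (ZMod p)[X]) ≠ 0 := by
      rw [show (4 : (ZMod p)[X]) = Polynomial.C (2 * 2) by
        rw [Polynomial.C_mul, Polynomial.C_ofNat]; norm_num]
      exact Polynomial.C_ne_zero.mpr (mul_ne_zero h2 h2)
    simp only [map_mul, map_ofNat, ha, map_add, map_pow, map_one, Polynomial.coe_mapRingHom,
      Polynomial.map_X, mul_eq_zero, h4, false_or] at h0
    rcases h0 with h0 | h0
    · exact Polynomial.X_ne_zero (eq_zero_of_pow_eq_zero h0)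
    · exact (Polynomial.monic_X_pow_add_C (1 : ZMod p) hp.out.ne_zero).ne_zero (by simpa using h0)
  -- As `a = X ^ p` with `p ≥ 3`, only `2 C` has a linear term; its coefficient is 2.
  · have h1 := congrArg (fun f => Polynomial.coeff f 1) h0
    have e : ∀ z : ℤ, (z : ℤ[X]) = Polynomial.C z := fun z => by simp
    rw [e, e, e, ← Polynomial.C_ofNat] at h1
    simp only [Polynomial.coe_mapRingHom, Polynomial.coeff_map, coeff_add, Polynomial.coeff_sub,
      Polynomial.coeff_C_mul, hr0, ha, coeff_X_pow, Polynomial.coeff_one, coeff_C, coeff_zero] at h1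
    rw [if_neg (by omega), if_neg (by omega), if_neg (by omega)] at h1
    simp at h1
    exact h2 h1

/-! ### The lift in size 3: vanishing over a field -/

/-- The polynomial `((x + √δ) ^ p + (x - √δ) ^ p) / 2`. -/
def evenBinomialPart {U : Type*} [CommRing U] (p : ℕ) (x δ : U) : U :=
  ∑ k ∈ Finset.range (p + 1), if Even k then x ^ (p - k) * δ ^ (k / 2) * (p.choose k : U) else 0

theorem map_evenBinomialPart {U U' : Type*} [CommRing U] [CommRing U'] (φ : U →+* U') (p : ℕ)
    (x δ : U) : φ (evenBinomialPart p x δ) = evenBinomialPart p (φ x) (φ δ) := by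
  simp only [evenBinomialPart, map_sum, apply_ite φ, map_mul, map_pow, map_natCast, map_zero]

theorem map_det_evenBinomialPart {U U' : Type*} [CommRing U] [CommRing U'] (φ : U →+* U') (p : ℕ)
    {n : ℕ} (M : Matrix (Fin n) (Fin n) U) :
    φ (Matrix.of fun i j => evenBinomialPart p (M i j) (M i j ^ 2 - M i i * M j j)).det =
      (Matrix.of fun i j => evenBinomialPart p (M.map φ i j)
        (M.map φ i j ^ 2 - M.map φ i i * M.map φ j j)).det := by
  rw [RingHom.map_det]
  congr 1
  ext1 i j
  simp only [RingHom.mapMatrix_apply, Matrix.map_apply, Matrix.of_apply, map_evenBinomialPart,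
    map_sub, map_mul, map_pow]

theorem map_det_dvd_det_evenBinomialPart {U U' : Type*} [CommRing U] [CommRing U'] (φ : U →+* U')
    (p : ℕ) {n : ℕ} (M : Matrix (Fin n) (Fin n) U) (h : M.det ∣
      (Matrix.of fun i j => evenBinomialPart p (M i j) (M i j ^ 2 - M i i * M j j)).det) :
    (M.map φ).det ∣ (Matrix.of fun i j => evenBinomialPart p (M.map φ i j)
        (M.map φ i j ^ 2 - M.map φ i i * M.map φ j j)).det := by
  have h1 := map_dvd φ h
  rwa [map_det_evenBinomialPart, RingHom.map_det] at h1

theorem two_mul_evenBinomialPart {U : Type*} [CommRing U] (p : ℕ) (x v : U) :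
    2 * evenBinomialPart p x (v ^ 2) = (x + v) ^ p + (x - v) ^ p := by
  rw [add_comm x v, sub_eq_neg_add, add_pow, add_pow, ← Finset.sum_add_distrib, evenBinomialPart,
    Finset.mul_sum]
  refine Finset.sum_congr rfl fun k _ => ?_
  split_ifs with hk
  · rw [hk.neg_pow, ← pow_mul, Nat.mul_div_cancel' hk.two_dvd]
    ring
  · rw [(Nat.not_even_iff_odd.mp hk).neg_pow]
    ring

/-- For `0 < k < p` the binomial coefficient is divisible by `p`, and `k = p` is dropped because `p`
is odd. -/
theorem exists_evenBinomialPart_eq {U : Type*} [CommRing U] {p : ℕ} (hp : p.Prime) (hodd : Odd p)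
    (x δ : U) : ∃ g, evenBinomialPart p x δ = x ^ p + p * g := by
  have : (p : U) ∣ evenBinomialPart p x δ - x ^ p := by
    rw [evenBinomialPart, Finset.sum_range_succ', if_pos Even.zero]
    simp only [Nat.sub_zero, Nat.zero_div, pow_zero, mul_one, Nat.choose_zero_right, Nat.cast_one,
      add_sub_cancel_right]
    refine Finset.dvd_sum fun k hk => ?_
    split_ifs with he
    · refine Dvd.dvd.mul_left (Nat.cast_dvd_cast (hp.dvd_choose_self k.succ_ne_zero ?_)) _
      have := Finset.mem_range.mp hk
      refine lt_of_le_of_ne this ?_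
      rintro rfl
      exact Nat.not_even_iff_odd.mpr hodd he
    · exact dvd_zero _
  obtain ⟨g, hg⟩ := this
  exact ⟨g, by rw [← hg]; ring⟩

/-- Here `δ = ((y_i z_j - y_j z_i) / 2)²`, so `x ± √δ` are `y_i z_j` and `y_j z_i`. The new matrix
comes from `y ^ p` and `z ^ p` in the same way, hence has rank at most 2. -/
theorem det_evenBinomialPart_eq_zero_of_eq {K : Type*} [Field K] [CharZero K] (p : ℕ)
    (M : Matrix (Fin 3) (Fin 3) K) (y z : Fin 3 → K)
    (h : ∀ i j, 2 * M i j = y i * z j + y j * z i) :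
    (Matrix.of fun i j => evenBinomialPart p (M i j) (M i j ^ 2 - M i i * M j j)).det = 0 := by
  have hK : (2 : K) ≠ 0 := two_ne_zero
  have hM : ∀ i j, M i j = (y i * z j + y j * z i) / 2 := fun i j => by
    rw [← h]
    field_simp
  have key : ∀ i j, 2 * evenBinomialPart p (M i j) (M i j ^ 2 - M i i * M j j) =
      y i ^ p * z j ^ p + y j ^ p * z i ^ p := by
    intro i j
    have hv : M i j ^ 2 - M i i * M j j = ((y i * z j - y j * z i) / 2) ^ 2 := by
      rw [hM i j, hM i i, hM j j]
      field_simp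
      ring
    rw [hv, two_mul_evenBinomialPart, hM i j, ← mul_pow, ← mul_pow]
    congr 2 <;> field_simp <;> ring
  have h2 : ((2 : K) • Matrix.of fun i j => evenBinomialPart p (M i j)
      (M i j ^ 2 - M i i * M j j)).det = 0 := by
    rw [Matrix.det_fin_three]
    simp only [Matrix.smul_apply, Matrix.of_apply, smul_eq_mul, key]
    ring
  rw [Matrix.det_smul] at h2
  exact (mul_eq_zero.mp h2).resolve_left (pow_ne_zero _ hK)

theorem det_evenBinomialPart_eq_zero_of_sq {K : Type*} [Field K] [CharZero K] (p : ℕ)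
    (a b c d e g w : K) (ha : a ≠ 0) (hw0 : w ≠ 0) (hw : w ^ 2 = d ^ 2 - a * b)
    (hdet : (a * b - d ^ 2) * c + (2 * d * e * g - a * g ^ 2 - b * e ^ 2) = 0)
    (M : Matrix (Fin 3) (Fin 3) K) (hM : M = !![a, d, e; d, b, g; e, g, c]) :
    (Matrix.of fun i j => evenBinomialPart p (M i j) (M i j ^ 2 - M i i * M j j)).det = 0 := by
  obtain ⟨μ, hμ⟩ : ∃ μ, μ * w = d * e - a * g := ⟨_ / w, div_mul_cancel₀ _ hw0⟩
  have hc : a * c = e ^ 2 - μ ^ 2 := by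
    refine mul_left_cancel₀ (pow_ne_zero 2 hw0) ?_
    linear_combination (a * c - e ^ 2) * hw - a * hdet + (μ * w + d * e - a * g) * hμ
  -- These factor the quadratic form of `M`: `w` and `μ` are square roots of `d² - a b` and `e² - a
  -- c`, with signs tied by `μ w = d e - a g`.
  refine det_evenBinomialPart_eq_zero_of_eq p M ![a, d + w, e + μ] ![1, (d - w) / a, (e - μ) / a]
    fun i j => ?_
  subst hM
  fin_cases i <;> fin_cases j <;> simp <;> field_simp
  · ring
  · ring
  · ring
  · ring
  · linear_combination 2 * hw
  · linear_combination 2 * hμ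
  · ring
  · linear_combination 2 * hμ
  · linear_combination 2 * hc

theorem det_evenBinomialPart_eq_zero {K : Type*} [Field K] [CharZero K] (p : ℕ)
    (a b c d e g : K) (ha : a ≠ 0) (hw : a * b - d ^ 2 ≠ 0)
    (hdet : (a * b - d ^ 2) * c + (2 * d * e * g - a * g ^ 2 - b * e ^ 2) = 0)
    (M : Matrix (Fin 3) (Fin 3) K) (hM : M = !![a, d, e; d, b, g; e, g, c]) :
    (Matrix.of fun i j => evenBinomialPart p (M i j) (M i j ^ 2 - M i i * M j j)).det = 0 := by
  let φ : K →+* AlgebraicClosure K := algebraMap K _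
  have hφ : Function.Injective φ := φ.injective
  obtain ⟨w, hw2⟩ := IsAlgClosed.exists_pow_nat_eq (φ (d ^ 2 - a * b)) two_pos
  have hw0 : w ≠ 0 := by
    rintro rfl
    rw [zero_pow two_ne_zero, ← map_zero φ] at hw2
    exact hw (by linear_combination hφ hw2)
  have : CharZero (AlgebraicClosure K) := charZero_of_injective_algebraMap hφ
  apply hφ
  rw [map_zero]
  have hdet' := congrArg φ hdet
  simp only [map_add, map_mul, map_sub, map_pow, map_ofNat, map_zero] at hdet' hw2
  rw [map_det_evenBinomialPart]
  refine det_evenBinomialPart_eq_zero_of_sq p (φ a) (φ b) (φ c) (φ d) (φ e) (φ g) w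
    ((map_ne_zero φ).mpr ha) hw0 hw2 hdet' _ ?_
  subst hM
  ext i j
  fin_cases i <;> fin_cases j <;> simp

/-! ### From vanishing to divisibility by the determinant -/

section

open Polynomial

theorem Polynomial.isPrimitive_C_mul_X_add_C {B : Type*} [CommRing B] (u v : B)
    (h : ∀ r : B, r ∣ u → r ∣ v → IsUnit r) : (C u * X + C v).IsPrimitive := by
  intro r hr
  rw [C_dvd_iff_dvd_coeff] at hr
  exact h r (by simpa using hr 1) (by simpa using hr 0)

/-- Gauss's lemma: a primitive linear polynomial divides `F` once its root in the fraction field is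
a root of `F`. -/
theorem Polynomial.C_mul_X_add_C_dvd {B : Type*} (K : Type*) [CommRing B] [Field K] [Algebra B K]
    [IsFractionRing B K] [IsDomain B]
    [UniqueFactorizationMonoid B] (u v : B) (hu : u ≠ 0) (h : ∀ r : B, r ∣ u → r ∣ v → IsUnit r)
    (F : B[X]) (hF : ∀ t : K, algebraMap B _ u * t + algebraMap B _ v = 0 →
      F.eval₂ (algebraMap B (K)) t = 0) : C u * X + C v ∣ F := by
  have hp := isPrimitive_C_mul_X_add_C u v h
  have hu' : algebraMap B (K) u ≠ 0 := by
    simpa using hu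
  by_cases hF0 : F = 0
  · rw [hF0]
    exact dvd_zero _
  have hK : (C u * X + C v).map (algebraMap B (K)) ∣
      F.map (algebraMap B (K)) := by
    have h1 := hF (-algebraMap B _ v / algebraMap B _ u) (by field_simp; ring)
    rw [eval₂_eq_eval_map] at h1
    have h2 := dvd_iff_isRoot.mpr h1
    refine dvd_trans ⟨C (algebraMap B _ u)⁻¹, ?_⟩ h2
    have h3 : (C (algebraMap B (K) u)) * C (algebraMap B (K) u)⁻¹ = 1 := by
      rw [← C_mul, mul_inv_cancel₀ hu', C_1]
    simp only [Polynomial.map_add, Polynomial.map_mul, map_C, map_X]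
    rw [div_eq_mul_inv, C_mul, C_neg]
    linear_combination (-X) * h3
  exact hp.dvd_of_fraction_map_dvd_fraction_map hK

end

-- A common divisor is constant in both variables, because it divides a nonzero constant. It then
-- divides the square-term coefficients `-a` and `-b`.
open Polynomial in
theorem isUnit_of_dvd_binaryDisc_of_dvd {B : Type*} [CommRing B] [IsDomain B] (a b d : B)
    (h : ∀ r : B, r ∣ a → r ∣ b → IsUnit r) (hΔ : a * b - d ^ 2 ≠ 0) (r : B[X][X])
    (h1 : r ∣ C (C (a * b - d ^ 2)))
    (h2 : r ∣ 2 * C (C d) * C X * X - C (C a) * X ^ 2 - C (C b) * C X ^ 2) : IsUnit r := by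
  have hr : r.natDegree = 0 := by
    have := natDegree_le_of_dvd h1 (C_ne_zero.mpr (C_ne_zero.mpr hΔ))
    rwa [natDegree_C, Nat.le_zero] at this
  obtain ⟨r, rfl⟩ := natDegree_eq_zero.mp hr
  have h1' : r ∣ C (a * b - d ^ 2) := by
    have := (C_dvd_iff_dvd_coeff _ _).mp h1 0
    rwa [coeff_C_zero] at this
  have hr' : r.natDegree = 0 := by
    have := natDegree_le_of_dvd h1' (C_ne_zero.mpr hΔ)
    rwa [natDegree_C, Nat.le_zero] at this
  obtain ⟨r, rfl⟩ := natDegree_eq_zero.mp hr'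
  have h2' : C (C r) ∣ C (C (2 * d) * X) * X - C (C a) * X ^ 2 - C (C b * X ^ 2) := by
    convert h2 using 1
    simp only [C_mul, C_pow, C_ofNat]
  rw [C_dvd_iff_dvd_coeff] at h2'
  have h3 := h2' 2
  have h4 := h2' 0
  simp only [coeff_sub, coeff_C_mul, coeff_X_pow, coeff_X, coeff_C] at h3 h4
  rw [C_dvd_iff_dvd_coeff] at h3 h4
  exact ((h r (by simpa using h3 0) (by simpa using h4 2)).map C).map C

-- The determinant is linear in the last diagonal entry, taken as the variable; `h` says that it is
-- primitive.
open Polynomial in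
theorem det_dvd_det_evenBinomialPart_of_primitive {B : Type*} (K : Type*) [Field K]
    [CommRing B] [Algebra B K] [IsFractionRing B K] [IsDomain B] [CharZero B]
    [UniqueFactorizationMonoid B] (p : ℕ) (a b d e g : B) (ha : a ≠ 0) (hΔ : a * b - d ^ 2 ≠ 0)
    (h : ∀ r : B, r ∣ a * b - d ^ 2 → r ∣ 2 * d * e * g - a * g ^ 2 - b * e ^ 2 → IsUnit r)
    (M : Matrix (Fin 3) (Fin 3) B[X]) (hM : M = !![C a, C d, C e; C d, C b, C g; C e, C g, X]) :
    M.det ∣ (Matrix.of fun i j => evenBinomialPart p (M i j) (M i j ^ 2 - M i i * M j j)).det := by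
  have hdet : M.det = C (a * b - d ^ 2) * X + C (2 * d * e * g - a * g ^ 2 - b * e ^ 2) := by
    rw [hM, Matrix.det_fin_three]
    simp [C_ofNat]
    ring
  rw [hdet]
  refine C_mul_X_add_C_dvd K _ _ hΔ h _ fun t ht => ?_
  let φ : B →+* K := algebraMap B K
  have hφ : Function.Injective φ := IsFractionRing.injective B K
  have : CharZero K := charZero_of_injective_algebraMap hφ
  rw [← coe_eval₂RingHom, map_det_evenBinomialPart]
  refine det_evenBinomialPart_eq_zero p (φ a) (φ b) t (φ d) (φ e) (φ g) ?_ ?_ ?_ _ ?_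
  · exact (map_ne_zero_iff φ hφ).mpr ha
  · rw [← map_mul, ← map_pow, ← map_sub]
    exact (map_ne_zero_iff φ hφ).mpr hΔ
  · have h2 : φ 2 = 2 := map_ofNat φ 2
    have ht' : φ (a * b - d ^ 2) * t + φ (2 * d * e * g - a * g ^ 2 - b * e ^ 2) = 0 := ht
    simpa only [map_sub, map_mul, map_pow, h2] using ht'
  · rw [hM]
    ext i j
    fin_cases i <;> fin_cases j <;> simp [φ]

open Polynomial in
theorem det_dvd_det_evenBinomialPart_of_hom {B U : Type*} [CommRing U] [CommRing B] [IsDomain B]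
    [CharZero B] [UniqueFactorizationMonoid B] (p : ℕ) (a b d e g : B) (ha : a ≠ 0)
    (hΔ : a * b - d ^ 2 ≠ 0)
    (h : ∀ r : B, r ∣ a * b - d ^ 2 → r ∣ 2 * d * e * g - a * g ^ 2 - b * e ^ 2 → IsUnit r)
    (φ : B →+* U) (c : U) (M : Matrix (Fin 3) (Fin 3) U)
    (hM : M = !![φ a, φ d, φ e; φ d, φ b, φ g; φ e, φ g, c]) :
    M.det ∣ (Matrix.of fun i j => evenBinomialPart p (M i j) (M i j ^ 2 - M i i * M j j)).det := by
  have key := map_det_dvd_det_evenBinomialPart (eval₂RingHom φ c) p _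
    (det_dvd_det_evenBinomialPart_of_primitive (FractionRing B) p a b d e g ha hΔ h _ rfl)
  have hNM : (!![C a, C d, C e; C d, C b, C g; C e, C g, X] : Matrix (Fin 3) (Fin 3) B[X]).map
      (eval₂RingHom φ c) = M := by
    rw [hM]
    ext i j
    fin_cases i <;> fin_cases j <;> simp
  rwa [hNM] at key

open Polynomial in
theorem det_dvd_det_evenBinomialPart_of_coprime {B U : Type*} [CommRing U] [CommRing B] [IsDomain B]
    [CharZero B] [UniqueFactorizationMonoid B] (p : ℕ) (a b d : B) (ha : a ≠ 0)
    (hΔ : a * b - d ^ 2 ≠ 0) (h : ∀ r : B, r ∣ a → r ∣ b → IsUnit r) (φ : B →+* U)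
    (M : Matrix (Fin 3) (Fin 3) U) (hM : M.IsSymm) (h00 : φ a = M 0 0) (h11 : φ b = M 1 1)
    (h01 : φ d = M 0 1) :
    M.det ∣ (Matrix.of fun i j => evenBinomialPart p (M i j) (M i j ^ 2 - M i i * M j j)).det := by
  have hΔ' : C (C a) * C (C b) - C (C d) ^ 2 = C (C (a * b - d ^ 2)) := by simp
  refine det_dvd_det_evenBinomialPart_of_hom p (C (C a)) (C (C b)) (C (C d)) (C X) X ?_ ?_ ?_
    (eval₂RingHom (eval₂RingHom φ (M 0 2)) (M 1 2)) (M 2 2) M ?_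
  · exact C_ne_zero.mpr (C_ne_zero.mpr ha)
  · rw [hΔ']
    exact C_ne_zero.mpr (C_ne_zero.mpr hΔ)
  · rw [hΔ']
    exact isUnit_of_dvd_binaryDisc_of_dvd a b d h hΔ
  · ext i j
    fin_cases i <;> fin_cases j <;>
      simp [h00, h11, h01, hM.apply 0 1, hM.apply 0 2, hM.apply 1 2]

-- The divisibility specialises along ring homomorphisms, so the generic case suffices. Its entries
-- are adjoined one at a time, to keep the determinant a univariate linear polynomial over a
-- factorial domain.
open Polynomial in
theorem det_dvd_det_evenBinomialPart {U : Type*} [CommRing U] (p : ℕ)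
    (M : Matrix (Fin 3) (Fin 3) U) (hM : M.IsSymm) :
    M.det ∣ (Matrix.of fun i j => evenBinomialPart p (M i j) (M i j ^ 2 - M i i * M j j)).det := by
  refine det_dvd_det_evenBinomialPart_of_coprime (B := ℤ[X][X][X]) p (C X) X (C (C X))
    (C_ne_zero.mpr X_ne_zero) ?_ ?_ (eval₂RingHom (eval₂RingHom (eval₂RingHom (Int.castRingHom U)
      (M 0 1)) (M 0 0)) (M 1 1)) M hM ?_ ?_ ?_
  · intro h0
    have := congrArg (fun f => coeff f 1) h0
    simp only [← C_pow, coeff_sub, coeff_C_mul, coeff_X_one, coeff_C_succ, sub_zero, mul_one,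
      coeff_zero] at this
    exact X_ne_zero this
  · intro r hra hrb
    have hr : r.natDegree = 0 := by
      have := natDegree_le_of_dvd hra (C_ne_zero.mpr X_ne_zero)
      rwa [natDegree_C, Nat.le_zero] at this
    obtain ⟨r, rfl⟩ := natDegree_eq_zero.mp hr
    have := (C_dvd_iff_dvd_coeff _ _).mp hrb 1
    rw [coeff_X_one] at this
    exact (isUnit_of_dvd_one this).map C
  · simp
  · simp
  · simp

/-! ### Conclusion -/

open MvPolynomial in
theorem frobeniusCongruence_three {p : ℕ} (hp : p.Prime) (hodd : Odd p) :
    FrobeniusCongruence p 3 := by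
  have hg : ∀ s : Sym2 (Fin 3), ∃ g : MvPolynomial (Sym2 (Fin 3)) ℤ, ∀ i j, s(i, j) = s →
      evenBinomialPart p (X s(i, j)) (X s(i, j) ^ 2 - X s(i, i) * X s(j, j)) = X s ^ p +
        (p : MvPolynomial (Sym2 (Fin 3)) ℤ) * g := by
    intro s
    induction s using Sym2.ind with | _ i j
    obtain ⟨g, hg⟩ := exists_evenBinomialPart_eq hp hodd (X s(i, j) : MvPolynomial (Sym2 (Fin 3)) ℤ)
      (X s(i, j) ^ 2 - X s(i, i) * X s(j, j))
    refine ⟨g, fun i' j' h => ?_⟩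
    rw [h]
    rcases Sym2.eq_iff.mp h with ⟨rfl, rfl⟩ | ⟨rfl, rfl⟩
    · exact hg
    · rw [← hg, mul_comm]
  choose g hg using hg
  obtain ⟨A, hA⟩ := det_dvd_det_evenBinomialPart p (genericSymmMatrix 3)
    (by
      ext1 i j
      simp [genericSymmMatrix, Sym2.eq_swap])
  refine ⟨g, A, 0, ?_⟩
  rw [mul_zero, add_zero, ← hA]
  congr 1
  ext1 i j
  exact (hg _ i j rfl).symm

theorem mainTheorem10 :
    (∀ (p : ℕ) [Fact p.Prime], Odd p → FrobeniusLiftsModPSq p (SymmDetHypersurface 3)) ∧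
    (∀ n : ℕ, 3 ≤ n → ¬ FrobeniusLiftsModPSq 2 (SymmDetHypersurface n)) ∧
    (∀ n : ℕ, 4 ≤ n → ∀ (p : ℕ) [Fact p.Prime], Odd p →
      ¬ FrobeniusLiftsModPSq p (SymmDetHypersurface n)) := by
  refine ⟨fun p hp hodd => (frobeniusCongruence_three hp.out hodd).lifts, fun n hn h => ?_,
    fun n hn p hp hodd h => ?_⟩
  · exact not_frobeniusCongruence_two_three
      ((frobeniusCongruence_of_lifts 2 n h).of_le two_ne_zero hn)
  · exact not_frobeniusCongruence_four p hodd
      ((frobeniusCongruence_of_lifts p n h).of_le hp.out.ne_zero hn)
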